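/- All quantum systems are finite-dimensional, and $\rho_{AB}$ denotes a quantum state (a positive semidefinite operator of trace one) of a bipartite system $AB$. Definitions. (i) A one-way LOCC channel is a map $\mathcal L^{\to}_{AB\to A'A''B'B''}=\sum_{x}\mathcal E^x_{A\to A'A''}\otimes\mathcal D^x_{B\to B'B''}$ (finite sum), where $\{\mathcal E^x\}_x$ is a quantum instrument (completely positive maps whose sum is trace preserving) and every $\mathcal D^x$ is a quantum channel. (ii) A private state holding $\log_2 k$ bits, $k\in\mathbb N$, $k\ge 1$, is a state $\gamma^k_{A'B'A''B''}=V(\Phi^k_{A'B'}\otimes\tau_{A''B''})V^\dagger$, where $\Phi^k=\frac1k\sum_{i,j=0}^{k-1}|i\rangle\langle j|\otimes|i\rangle\langle j|$, $\tau_{A''B''}$ is an arbitrary state and $V=\sum_{i=0}^{k-1}|i\rangle\langle i|_{A'}\otimes I_{B'}\otimes U^i_{A''B''}$ with unitaries $U^i$. The effect of its privacy test is $\Pi^\gamma=V(\Phi^k_{A'B'}\otimes I_{A''B''})V^\dagger$. (iii) With the fidelity $F(\rho,\sigma)=\big(\operatorname{Tr}\sqrt{\sqrt\sigma\,\rho\,\sqrt\sigma}\big)^2$,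 the one-shot, one-way distillable key is $$K^{\varepsilon,\to}_D(\rho_{AB})=\sup\left\{\log_2 k : k\ge 1,\ F\big(\mathcal L^{\to}(\rho_{AB}),\gamma^k_{A'B'A''B''}\big)\ge 1-\varepsilon\right\},$$ the supremum being over all $k$, all private states $\gamma^k$ (with shield systems $A'',B''$ of arbitrary dimensions) and all one-way LOCC channels $\mathcal L^{\to}$; here Alice holds $A'A''$ and Bob holds $B'B''$. (iv) $\mathcal F(\rho_{AB})$ is the set of the states $\operatorname{Tr}_B[\omega_{ABE}]$, where $E$ is a copy of $B$ and $\omega_{ABE}$ is a state with $\operatorname{Tr}_E[\omega_{ABE}]=\rho_{AB}$ (the marginal on $AE$ being regarded as a state of $AB$). Let $$D^\varepsilon_{\min}(\rho\|\sigma)=-\log_2\inf_{0\le\Lambda\le I}\{\operatorname{Tr}[\Lambda\sigma]:\operatorname{Tr}[\Lambda\rho]\ge 1-\varepsilon\},\qquad E^{u,\varepsilon}_{\min}(\rho_{AB})=\inf_{\sigma_{AB}\in\mathcal F(\rho_{AB})}\tfrac12 D^\varepsilon_{\min}(\rho_{AB}\|\sigma_{AB}),$$ $$J^\varepsilon_{\min}(\rho_{AB})=2^{-2E^{u,\varepsilon}_{\min}(\rho_{AB})}.$$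 Statement. Fix $\varepsilon\in(0,1)$. (a) Let $\rho_{AB}$ be a quantum state such that $$\sqrt\varepsilon<J^\varepsilon_{\min}(\rho_{AB})\le\frac14+\frac\varepsilon2+\frac{\sqrt{3\varepsilon(1-\varepsilon)}}2 .$$ Then $$K^{\varepsilon,\to}_D(\rho_{AB})\le-\frac12\log_2\!\left(J^\varepsilon_{\min}(\rho_{AB})-\sqrt\varepsilon\right).$$ (b) Let $k\ge1$, let $\gamma^k=V(\Phi^k\otimes\tau)V^\dagger$ be a private state and let $\sigma$ be a state of the same systems with $F(\sigma,\gamma^k)\ge1-\varepsilon$. Then every $\omega\in\mathcal F(\sigma)$ (with respect to the bipartition Alice | Bob) passes the corresponding privacy test with probability $\operatorname{Tr}[\Pi^\gamma\omega]\le\frac1{k^2}+\sqrt\varepsilon$. -/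

import Mathlib

open scoped ComplexOrder MatrixOrder Kronecker TensorProduct ENNReal

/-!
Finite-dimensional quantum systems are represented by finite index types: the system with index
type `A` has Hilbert space `ℂ^A` with computational basis `A`, its operators are `Matrix A A ℂ`,
and the composite of `A` and `B` has index type `A × B`.
-/

noncomputable section

namespace OneWayKey

/-- A quantum state (density operator): positive semidefinite with unit trace. -/
def IsState {A : Type*} [Fintype A] (ρ : Matrix A A ℂ) : Prop :=
  ρ.PosSemidef ∧ ρ.trace = 1

/-! ### Channels -/

/-- The tensor product `𝓔 ⊗ 𝓓` of two linear maps on operators, i.e. the linear map with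
`(𝓔 ⊗ 𝓓) (X ⊗ Y) = 𝓔 X ⊗ 𝓓 Y`. -/
def tensorMap {A A' B B' : Type*} [Fintype A] [DecidableEq A] [Fintype A'] [DecidableEq A']
    [Fintype B] [DecidableEq B] [Fintype B'] [DecidableEq B']
    (𝓔 : Matrix A A ℂ →ₗ[ℂ] Matrix A' A' ℂ) (𝓓 : Matrix B B ℂ →ₗ[ℂ] Matrix B' B' ℂ) :
    Matrix (A × B) (A × B) ℂ →ₗ[ℂ] Matrix (A' × B') (A' × B') ℂ :=
  (kroneckerLinearEquiv A' A' B' B' ℂ).toLinearMap ∘ₗ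
    TensorProduct.map 𝓔 𝓓 ∘ₗ (kroneckerLinearEquiv A A B B ℂ).symm.toLinearMap

/-- Complete positivity: `id_n ⊗ 𝓔` is a positive map for every `n`. -/
def IsCP {A A' : Type*} [Fintype A] [DecidableEq A] [Fintype A'] [DecidableEq A']
    (𝓔 : Matrix A A ℂ →ₗ[ℂ] Matrix A' A' ℂ) : Prop :=
  ∀ (n : ℕ) (M : Matrix (Fin n × A) (Fin n × A) ℂ), M.PosSemidef →
    (tensorMap (LinearMap.id : Matrix (Fin n) (Fin n) ℂ →ₗ[ℂ] Matrix (Fin n) (Fin n) ℂ) 𝓔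
      M).PosSemidef

/-- Trace preservation. -/
def IsTP {A A' : Type*} [Fintype A] [Fintype A']
    (𝓔 : Matrix A A ℂ →ₗ[ℂ] Matrix A' A' ℂ) : Prop :=
  ∀ M : Matrix A A ℂ, (𝓔 M).trace = M.trace

/-- A quantum channel is a completely positive, trace-preserving linear map. -/
def IsChannel {A A' : Type*} [Fintype A] [DecidableEq A] [Fintype A'] [DecidableEq A']
    (𝓔 : Matrix A A ℂ →ₗ[ℂ] Matrix A' A' ℂ) : Prop :=
  IsCP 𝓔 ∧ IsTP 𝓔

/-- A quantum instrument: finitely many completely positive maps that sum to a channel. -/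
def IsInstrument {A A' X : Type*} [Fintype A] [DecidableEq A] [Fintype A'] [DecidableEq A']
    [Fintype X] (𝓔 : X → (Matrix A A ℂ →ₗ[ℂ] Matrix A' A' ℂ)) : Prop :=
  (∀ x, IsCP (𝓔 x)) ∧ IsTP (∑ x, 𝓔 x)

/-- One-way LOCC channels: Alice applies an instrument and sends the classical outcome `x` to Bob,
who applies a channel that depends on `x`. -/
def IsOneWayLOCC {A A' B B' : Type*} [Fintype A] [DecidableEq A] [Fintype A'] [DecidableEq A']
    [Fintype B] [DecidableEq B] [Fintype B'] [DecidableEq B']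
    (𝓛 : Matrix (A × B) (A × B) ℂ →ₗ[ℂ] Matrix (A' × B') (A' × B') ℂ) : Prop :=
  ∃ (r : ℕ) (𝓔 : Fin r → (Matrix A A ℂ →ₗ[ℂ] Matrix A' A' ℂ))
    (𝓓 : Fin r → (Matrix B B ℂ →ₗ[ℂ] Matrix B' B' ℂ)),
    IsInstrument 𝓔 ∧ (∀ x, IsChannel (𝓓 x)) ∧ 𝓛 = ∑ x, tensorMap (𝓔 x) (𝓓 x)

/-! ### Private states -/

/-- The maximally entangled state `Φ^k = (1/k) ∑_{i,j} |i⟩⟨j| ⊗ |i⟩⟨j|`. -/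
def maxEnt (k : ℕ) : Matrix (Fin k × Fin k) (Fin k × Fin k) ℂ :=
  (1 / (k : ℂ)) • ∑ i : Fin k, ∑ j : Fin k, Matrix.single i j 1 ⊗ₖ Matrix.single i j 1

/-- The twisting unitary `V = ∑_i |i⟩⟨i|_A ⊗ I_B ⊗ U^i`, where the `U^i` are unitaries on the
shield systems `S` (Alice) and `T` (Bob). -/
def twist {k : ℕ} {S T : Type*} [Fintype S] [DecidableEq S] [Fintype T] [DecidableEq T]
    (U : Fin k → Matrix.unitaryGroup (S × T) ℂ) :
    Matrix ((Fin k × Fin k) × (S × T)) ((Fin k × Fin k) × (S × T)) ℂ :=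
  ∑ i : Fin k, (Matrix.single i i 1 ⊗ₖ (1 : Matrix (Fin k) (Fin k) ℂ)) ⊗ₖ
    (U i : Matrix (S × T) (S × T) ℂ)

/-- Regroup the systems from (keys, shields) to (Alice's key and shield, Bob's key and shield). -/
def regroup {K S T : Type*} (M : Matrix ((K × K) × (S × T)) ((K × K) × (S × T)) ℂ) :
    Matrix ((K × S) × (K × T)) ((K × S) × (K × T)) ℂ :=
  Matrix.reindex (Equiv.prodProdProdComm K K S T) (Equiv.prodProdProdComm K K S T) M

/-- The private state `V (Φ^k ⊗ τ) V†` holding `log₂ k` secret bits. -/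
def privateState {k : ℕ} {S T : Type*} [Fintype S] [DecidableEq S] [Fintype T] [DecidableEq T]
    (U : Fin k → Matrix.unitaryGroup (S × T) ℂ) (τ : Matrix (S × T) (S × T) ℂ) :
    Matrix ((Fin k × S) × (Fin k × T)) ((Fin k × S) × (Fin k × T)) ℂ :=
  regroup (twist U * (maxEnt k ⊗ₖ τ) * (twist U).conjTranspose)

/-- The effect `V (Φ^k ⊗ I) V†` of the privacy test. -/
def privacyTest {k : ℕ} {S T : Type*} [Fintype S] [DecidableEq S] [Fintype T] [DecidableEq T]
    (U : Fin k → Matrix.unitaryGroup (S × T) ℂ) :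
    Matrix ((Fin k × S) × (Fin k × T)) ((Fin k × S) × (Fin k × T)) ℂ :=
  regroup (twist U * (maxEnt k ⊗ₖ (1 : Matrix (S × T) (S × T) ℂ)) * (twist U).conjTranspose)

/-- The fidelity `F(ρ, σ) = (Tr √(√σ ρ √σ))²`. -/
def fidelity {A : Type*} [Fintype A] [DecidableEq A] (ρ σ : Matrix A A ℂ) : ℝ :=
  ((CFC.sqrt (CFC.sqrt σ * ρ * CFC.sqrt σ)).trace.re) ^ 2

/-! ### One-shot, one-way distillable key -/

/-- A one-way LOCC channel takes `ρ_{AB}` to a state whose fidelity with some private state of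
key dimension `k` (and shields of arbitrary finite dimensions) is at least `1 - ε`. -/
def KeyAchievable {A B : Type*} [Fintype A] [DecidableEq A] [Fintype B] [DecidableEq B]
    (ε : ℝ) (ρ : Matrix (A × B) (A × B) ℂ) (k : ℕ) : Prop :=
  ∃ (s t : ℕ) (U : Fin k → Matrix.unitaryGroup (Fin s × Fin t) ℂ)
    (τ : Matrix (Fin s × Fin t) (Fin s × Fin t) ℂ)
    (𝓛 : Matrix (A × B) (A × B) ℂ →ₗ[ℂ]
      Matrix ((Fin k × Fin s) × (Fin k × Fin t)) ((Fin k × Fin s) × (Fin k × Fin t)) ℂ),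
    IsState τ ∧ IsOneWayLOCC 𝓛 ∧ 1 - ε ≤ fidelity (𝓛 ρ) (privateState U τ)

/-- The one-shot, one-way distillable key `K_D^{ε,→}(ρ_{AB})`, in bits. -/
def distillableKey {A B : Type*} [Fintype A] [DecidableEq A] [Fintype B] [DecidableEq B]
    (ε : ℝ) (ρ : Matrix (A × B) (A × B) ℂ) : EReal :=
  ⨆ (k : ℕ) (_ : 1 ≤ k) (_ : KeyAchievable ε ρ k), ((Real.logb 2 k : ℝ) : EReal)

/-! ### Smooth-min unextendible entanglement -/

/-- The partial trace over the third system. -/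
def traceE {A B E : Type*} [Fintype E] (ω : Matrix ((A × B) × E) ((A × B) × E) ℂ) :
    Matrix (A × B) (A × B) ℂ :=
  Matrix.of fun p q => ∑ e, ω (p, e) (q, e)

/-- The partial trace over the second system. -/
def traceB {A B E : Type*} [Fintype B] (ω : Matrix ((A × B) × E) ((A × B) × E) ℂ) :
    Matrix (A × E) (A × E) ℂ :=
  Matrix.of fun p q => ∑ b, ω ((p.1, b), p.2) ((q.1, b), q.2)

/-- The extensions `ω_{ABE}` of `ρ_{AB}`, with `E` a copy of `B`. -/
def extensions {A B : Type*} [Fintype A] [Fintype B] (ρ : Matrix (A × B) (A × B) ℂ) :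
    Set (Matrix ((A × B) × B) ((A × B) × B) ℂ) :=
  {ω | IsState ω ∧ traceE ω = ρ}

/-- The state-dependent free states `𝓕(ρ_{AB})`: the marginals on `AE` of the extensions. -/
def freeStates {A B : Type*} [Fintype A] [Fintype B] (ρ : Matrix (A × B) (A × B) ℂ) :
    Set (Matrix (A × B) (A × B) ℂ) :=
  traceB '' extensions ρ

/-- `log₂ : [0, ∞] → [-∞, ∞]`. -/
def elog2 (x : ℝ≥0∞) : EReal := ENNReal.log x / ((Real.log 2 : ℝ) : EReal)

/-- `x ↦ 2 ^ x : [-∞, ∞] → [0, ∞]`. -/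
def epow2 (x : EReal) : ℝ≥0∞ := EReal.exp (x * ((Real.log 2 : ℝ) : EReal))

/-- The smooth min-relative entropy
`D_min^ε(ρ‖σ) = -log₂ inf {Tr[Λσ] : 0 ≤ Λ ≤ I, Tr[Λρ] ≥ 1 - ε}`, which may be `+∞`. -/
def smoothMinRelEntropy {A : Type*} [Fintype A] [DecidableEq A] (ε : ℝ) (ρ σ : Matrix A A ℂ) :
    EReal :=
  -elog2 (⨅ (Λ : Matrix A A ℂ) (_ : 0 ≤ Λ ∧ Λ ≤ 1 ∧ 1 - ε ≤ (Λ * ρ).trace.re),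
    ENNReal.ofReal (Λ * σ).trace.re)

/-- The smooth-min unextendible entanglement
`E_min^{u,ε}(ρ_{AB}) = inf_{σ ∈ 𝓕(ρ)} (1/2) D_min^ε(ρ‖σ)`. -/
def smoothMinUnextEnt {A B : Type*} [Fintype A] [DecidableEq A] [Fintype B] [DecidableEq B]
    (ε : ℝ) (ρ : Matrix (A × B) (A × B) ℂ) : EReal :=
  ⨅ σ ∈ freeStates ρ, ((1 / 2 : ℝ) : EReal) * smoothMinRelEntropy ε ρ σ

/-- `J_min^ε(ρ_{AB}) = 2 ^ (-2 E_min^{u,ε}(ρ_{AB}))`; it is finite for a state and `0 ≤ ε ≤ 1`,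
where `E_min^{u,ε} ≥ 0`. -/
def Jmin {A B : Type*} [Fintype A] [DecidableEq A] [Fintype B] [DecidableEq B]
    (ε : ℝ) (ρ : Matrix (A × B) (A × B) ℂ) : ℝ :=
  (epow2 (-(2 * smoothMinUnextEnt ε ρ))).toReal

end OneWayKey

end

/-! The bound rests on monogamy of the privacy test. On an extension `ω_{ABE}`, let `P` test Alice
against Bob and `Q` be the same test of Alice against `E`. Both are projections, and
`privacyTest_sandwich` gives `P Q P = k⁻² P`: after a passed `P`, the test `Q` succeeds with
probability exactly `1 / k²`.

The error is controlled by a gentle-measurement argument. If `ω` passes `P` with probability `f`,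
inserting `Q + (1 - Q) = 1` into `Tr[Pω]` and applying Cauchy-Schwarz to each term shows that the
outcome distribution of `Q` on `ω` has classical fidelity at least `f` with `(k⁻², 1 - k⁻²)`. Hence
the success probabilities differ by at most `√(1 - f)` (`trace_re_le_add_sqrt`). Fidelity with a
private state bounds the probability of passing its test from below (`fidelity_le_trace`), so `1 - f
≤ ε`; this is (b).

For (a), the test is pulled back through the adjoint of the LOCC channel to an effect `Λ` on the
input. It accepts `ρ` with probability at least `1 - ε`. Since the classical message can be copied
and sent to `E` as well, free states go to free states (`IsOneWayLOCC.map_mem_freeStates`), and (b)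
bounds `Λ` on all of `𝓕(ρ)`. So `J ≤ k⁻² + √ε` for every achievable `k`, and taking logarithms
finishes. -/

namespace OneWayKey

open Matrix

/-! ### Hilbert-Schmidt Cauchy-Schwarz. -/

section CauchySchwarz

variable {m n : Type*} [Fintype m] [Fintype n]

/-- The Cauchy-Schwarz inequality for the Hilbert-Schmidt inner product. -/
theorem norm_trace_conjTranspose_mul_sq_le (X Y : Matrix m n ℂ) :
    ‖(Xᴴ * Y).trace‖ ^ 2 ≤ (Xᴴ * X).trace.re * (Yᴴ * Y).trace.re := by
  let v : Matrix m n ℂ → EuclideanSpace ℂ (n × m) := fun Z => WithLp.toLp 2 fun p => Z p.2 p.1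
  have key : ∀ Z W : Matrix m n ℂ, inner ℂ (v Z) (v W) = (Zᴴ * W).trace := by
    intro Z W
    simp [v, PiLp.inner_apply, Matrix.trace, Matrix.mul_apply, Fintype.sum_prod_type, mul_comm]
  have hn : ∀ Z : Matrix m n ℂ, ‖v Z‖ ^ 2 = (Zᴴ * Z).trace.re := by
    intro Z
    rw [← key, ← inner_self_eq_norm_sq (𝕜 := ℂ)]
    rfl
  rw [← key, ← hn, ← hn, ← mul_pow]
  exact pow_le_pow_left₀ (norm_nonneg _) (norm_inner_le_norm _ _) 2

theorem trace_conjTranspose_mul_self_re_nonneg (X : Matrix m n ℂ) : 0 ≤ (Xᴴ * X).trace.re :=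
  (Complex.le_def.1 (posSemidef_conjTranspose_mul_self X).trace_nonneg).1

end CauchySchwarz

/-! ### Fidelity and projective tests. -/

section Fidelity

variable {m : Type*} [Fintype m] [DecidableEq m]

/-- Every positive semidefinite matrix has a self-adjoint pseudo-inverse of its square root. -/
theorem exists_pseudoinverse_sqrt {H : Matrix m m ℂ} (hH : H.PosSemidef) :
    ∃ G : Matrix m m ℂ, Gᴴ = G ∧ G * H = CFC.sqrt H ∧ G * H * G * G = G := by
  have hc : ∀ f : ℝ → ℝ, ContinuousOn f (spectrum ℝ H) := fun f =>
    (Matrix.finite_real_spectrum (A := H)).continuousOn f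
  have h0 : ∀ x ∈ spectrum ℝ H, 0 ≤ x := fun x hx => spectrum_nonneg_of_nonneg hH.nonneg hx
  have hsa : IsSelfAdjoint H := hH.1
  have hid : cfc (fun x : ℝ => x) H = H := cfc_id' ℝ H
  -- Since `(√0)⁻¹ = 0`, this function of `H` inverts `√H` on its support and vanishes on its
  -- kernel.
  have hGH : cfc (fun x : ℝ => (√x)⁻¹) H * H = cfc (fun x : ℝ => √x) H := by
    conv_lhs => rw [← hid, cfc_id' ℝ H]
    nth_rewrite 2 [← hid]
    rw [← cfc_mul _ _ H (hc _) (hc _)]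
    refine cfc_congr fun x hx => ?_
    change (√x)⁻¹ * x = √x
    nth_rewrite 2 [← Real.mul_self_sqrt (h0 x hx)]
    by_cases h : √x = 0
    · simp [h]
    · field_simp
  refine ⟨cfc (fun x : ℝ => (√x)⁻¹) H, ?_, ?_, ?_⟩
  · exact (cfc_predicate (fun x : ℝ => (√x)⁻¹) H : IsSelfAdjoint _)
  · rw [hGH, CFC.sqrt_eq_real_sqrt H hH.nonneg, cfcₙ_eq_cfc (hf := Real.continuous_sqrt.continuousOn)]
  · rw [hGH, ← cfc_mul _ _ H (hc _) (hc _), ← cfc_mul _ _ H (hc _) (hc _)]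
    refine cfc_congr fun x hx => ?_
    change √x * (√x)⁻¹ * (√x)⁻¹ = (√x)⁻¹
    by_cases h : √x = 0
    · simp [h]
    · field_simp

/-- A state that passes a projective test with certainty has fidelity with any `σ` at most the
probability that `σ` passes the test. -/
theorem fidelity_le_trace {σ γ P : Matrix m m ℂ} (hσ : σ.PosSemidef) (hγ : IsState γ)
    (hP : Pᴴ = P) (hPP : P * P = P) (hPγ : P * γ = γ) :
    fidelity σ γ ≤ (P * σ).trace.re := by
  set R := CFC.sqrt γ with hR
  set M := CFC.sqrt σ with hM
  have hRR : R * R = γ := CFC.sqrt_mul_sqrt_self γ hγ.1.nonneg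
  have hMM : M * M = σ := CFC.sqrt_mul_sqrt_self σ hσ.nonneg
  have hRh : Rᴴ = R := (Matrix.nonneg_iff_posSemidef.1 (CFC.sqrt_nonneg γ)).1
  have hMh : Mᴴ = M := (Matrix.nonneg_iff_posSemidef.1 (CFC.sqrt_nonneg σ)).1
  -- `(R - PR)(R - PR)ᴴ = (1 - P) γ (1 - P) = 0`.
  have hPR : P * R = R := by
    have : ((R - P * R)ᴴ)ᴴ * (R - P * R)ᴴ = 0 := by
      rw [conjTranspose_conjTranspose, conjTranspose_sub, conjTranspose_mul, hRh, hP]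
      calc (R - P * R) * (R - R * P) = (R * R - P * (R * R)) - (R * R - P * (R * R)) * P := by
            noncomm_ring
        _ = 0 := by rw [hRR, hPγ]; simp
    rw [conjTranspose_mul_self_eq_zero, conjTranspose_eq_zero] at this
    exact (sub_eq_zero.1 this).symm
  have hRP : R * P = R := by
    have := congrArg conjTranspose hPR
    rwa [conjTranspose_mul, hRh, hP] at this
  have hH : (R * σ * R).PosSemidef := by
    have := hσ.mul_mul_conjTranspose_same R
    rwa [hRh] at this
  obtain ⟨G, hG, hGH, hGG⟩ := exists_pseudoinverse_sqrt hH
  -- The partial isometry of the polar decomposition of `M * R`: `S M R = √(RσR)`. It avoids having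
  -- to extend to a unitary.
  set S := G * R * M with hS
  have hSh : Sᴴ = M * R * G := by
    rw [hS, conjTranspose_mul, conjTranspose_mul, hG, hRh, hMh, Matrix.mul_assoc]
  have hSS : S * Sᴴ * S = S := by
    calc S * Sᴴ * S = (G * (R * (M * M) * R) * G * G) * R * M := by
          rw [hSh, hS]; noncomm_ring
      _ = S := by rw [hMM, hGG]
  have hQ : CFC.sqrt (R * σ * R) = S * M * P * R := by
    rw [← hGH, Matrix.mul_assoc _ P, hPR, ← hMM, hS]; noncomm_ring
  have htr : (CFC.sqrt (R * σ * R)).trace = (Rᴴ * (S * M * P)).trace := by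
    rw [hQ, trace_mul_comm, hRh]
  have hcs := norm_trace_conjTranspose_mul_sq_le R (S * M * P)
  rw [← htr, hRh, hRR, hγ.2, Complex.one_re, one_mul] at hcs
  have hpos := trace_conjTranspose_mul_self_re_nonneg ((1 - Sᴴ * S) * (M * P))
  -- Pythagoras for the projection `SᴴS`: the norm of `S M P` is at most that of `M P`.
  have hexp : ((1 - Sᴴ * S) * (M * P))ᴴ * ((1 - Sᴴ * S) * (M * P)) =
      P * σ * P - (S * M * P)ᴴ * (S * M * P) := by
    have h1 : (1 - Sᴴ * S)ᴴ = 1 - Sᴴ * S := by simp [conjTranspose_mul]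
    have h2 : (1 - Sᴴ * S) * (1 - Sᴴ * S) = 1 - Sᴴ * S := by
      calc (1 - Sᴴ * S) * (1 - Sᴴ * S) = 1 - Sᴴ * S - Sᴴ * (S - S * Sᴴ * S) := by noncomm_ring
        _ = _ := by rw [hSS]; simp
    calc _ = (M * P)ᴴ * ((1 - Sᴴ * S)ᴴ * (1 - Sᴴ * S)) * (M * P) := by
            rw [conjTranspose_mul]; noncomm_ring
      _ = P * (M * M) * P - (S * M * P)ᴴ * (S * M * P) := by
            rw [h1, h2, conjTranspose_mul, conjTranspose_mul (S * M), conjTranspose_mul S, hMh, hP]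
            noncomm_ring
      _ = _ := by rw [hMM]
  rw [hexp, trace_sub, Complex.sub_re, sub_nonneg] at hpos
  have h3 : (P * σ * P).trace = (P * σ).trace := by
    rw [trace_mul_comm, ← Matrix.mul_assoc, hPP]
  rw [h3] at hpos
  unfold fidelity
  refine le_trans ?_ (hcs.trans hpos)
  rw [← sq_abs]
  exact pow_le_pow_left₀ (abs_nonneg _) (Complex.abs_re_le_norm _) 2

end Fidelity

/-! ### Two projections in succession. -/

section GentleMeasurement

/-- With `p = sin² α` and `q = sin² β`, the hypothesis reads `√f ≤ cos (α - β)`, while `p - q = sin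
(α - β) sin (α + β)`; therefore `(p - q)² ≤ sin² (α - β) ≤ 1 - f`. -/
theorem le_add_sqrt_one_sub_of_sqrt_le {f p q : ℝ} (hp0 : 0 ≤ p) (hp1 : p ≤ 1) (hq0 : 0 ≤ q)
    (hq1 : q ≤ 1) (hf0 : 0 ≤ f) (h : √f ≤ √(q * p) + √((1 - q) * (1 - p))) :
    p ≤ q + √(1 - f) := by
  have hq1' := sub_nonneg.2 hq1
  have hp1' := sub_nonneg.2 hp1
  have h2 : f ≤ (√(q * p) + √((1 - q) * (1 - p))) ^ 2 := by
    rw [← Real.sq_sqrt hf0]; exact pow_le_pow_left₀ (Real.sqrt_nonneg _) h 2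
  rw [Real.sqrt_mul hq0, Real.sqrt_mul hq1'] at h2
  have a1 := Real.sq_sqrt hp0
  have a2 := Real.sq_sqrt hq0
  have a3 := Real.sq_sqrt hp1'
  have a4 := Real.sq_sqrt hq1'
  set a := √p
  set b := √q
  set c := √(1 - p)
  set d := √(1 - q)
  have key : (p - q) ^ 2 ≤ 1 - f := by
    have e1 : a ^ 2 + c ^ 2 = 1 := by linarith
    have e2 : b ^ 2 + d ^ 2 = 1 := by linarith
    have e3 : (b * a + d * c) ^ 2 + (a * d - b * c) ^ 2 = 1 := by
      calc _ = (a ^ 2 + c ^ 2) * (b ^ 2 + d ^ 2) := by ring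
        _ = 1 := by rw [e1, e2, one_mul]
    have e4 : (a * d + b * c) ^ 2 + (a * b - c * d) ^ 2 = 1 := by
      calc _ = (a ^ 2 + c ^ 2) * (b ^ 2 + d ^ 2) := by ring
        _ = 1 := by rw [e1, e2, one_mul]
    have e5 : p - q = (a * d - b * c) * (a * d + b * c) := by
      calc p - q = a ^ 2 * (1 - b ^ 2) - b ^ 2 * (1 - a ^ 2) := by rw [a1, a2]; ring
        _ = a ^ 2 * d ^ 2 - b ^ 2 * c ^ 2 := by rw [a1, a2, a3, a4]
        _ = _ := by ring
    have e6 : (p - q) ^ 2 ≤ (a * d - b * c) ^ 2 := by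
      rw [e5, mul_pow]
      exact mul_le_of_le_one_right (sq_nonneg _) (by nlinarith [sq_nonneg (a * b - c * d)])
    linarith
  have := (le_abs_self _).trans (Real.abs_le_sqrt key)
  linarith

variable {m : Type*} [Fintype m] [DecidableEq m]

/-- If two projections satisfy `P Q P = c P`, then a state that passes the test `P` with
probability `f` passes the test `Q` with probability at most `c + √(1 - f)`. -/
theorem trace_re_le_add_sqrt {P Q ω : Matrix m m ℂ} {c : ℝ} (hω : IsState ω)
    (hP : Pᴴ = P) (hPP : P * P = P) (hQ : Qᴴ = Q) (hQQ : Q * Q = Q) (hc0 : 0 ≤ c) (hc1 : c ≤ 1)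
    (hPQP : P * Q * P = (c : ℂ) • P) :
    (Q * ω).trace.re ≤ c + √(1 - (P * ω).trace.re) := by
  obtain ⟨M, hM⟩ : ∃ M : Matrix m m ℂ, ω = M * Mᴴ := by
    obtain ⟨C, hC⟩ := CStarAlgebra.nonneg_iff_eq_star_mul_self.1 hω.1.nonneg
    exact ⟨Cᴴ, by rw [hC, conjTranspose_conjTranspose, star_eq_conjTranspose]⟩
  have proj : ∀ E : Matrix m m ℂ, Eᴴ = E → E * E = E →
      ∀ Z : Matrix m m ℂ, (E * Z)ᴴ * (E * Z) = Zᴴ * E * Z := by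
    intro E h1 h2 Z
    rw [conjTranspose_mul, h1, Matrix.mul_assoc, ← Matrix.mul_assoc E E, h2, ← Matrix.mul_assoc]
  have tr : ∀ E : Matrix m m ℂ, (Mᴴ * E * M).trace = (E * ω).trace := by
    intro E
    rw [Matrix.mul_assoc, trace_mul_comm, hM, Matrix.mul_assoc]
  have hQ' : (1 - Q)ᴴ = 1 - Q := by simp [hQ]
  have hQQ' : (1 - Q) * (1 - Q) = 1 - Q := by
    rw [sub_mul, mul_sub, mul_sub, hQQ]; simp
  have hone : ((1 : Matrix m m ℂ) * ω).trace.re = 1 := by rw [one_mul, hω.2, Complex.one_re]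
  have bounds : ∀ E : Matrix m m ℂ, Eᴴ = E → E * E = E →
      0 ≤ (E * ω).trace.re := by
    intro E h1 h2
    rw [← tr, ← proj E h1 h2]
    exact trace_conjTranspose_mul_self_re_nonneg _
  set f := (P * ω).trace.re with hf
  set p := (Q * ω).trace.re with hp
  have hp' : ((1 - Q) * ω).trace.re = 1 - p := by
    rw [sub_mul, trace_sub, Complex.sub_re, hone]
  have hp0 : 0 ≤ p := bounds Q hQ hQQ
  have hp1 : 0 ≤ 1 - p := hp' ▸ bounds _ hQ' hQQ'
  have hf0 : 0 ≤ f := bounds P hP hPP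
  have hc1' := sub_nonneg.2 hc1
  -- Cauchy-Schwarz for `E P M` and `E M`, whose squared norms are `e * f` and `x`. It serves both
  -- for `Q` and for `1 - Q`, where the constant is `1 - c`.
  have cs : ∀ E : Matrix m m ℂ, Eᴴ = E → E * E = E → ∀ e x : ℝ, P * E * P = (e : ℂ) • P →
      (E * ω).trace.re = x → |(P * E * ω).trace.re| ≤ √f * √(e * x) := by
    intro E h1 h2 e x h3 h4
    have h := norm_trace_conjTranspose_mul_sq_le (E * (P * M)) (E * M)
    rw [proj E h1 h2, proj E h1 h2, tr, h4] at h
    have e1 : ((P * M)ᴴ * E * (P * M)).trace.re = e * f := by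
      rw [show (P * M)ᴴ * E * (P * M) = Mᴴ * (P * E * P) * M by
        rw [conjTranspose_mul, hP]; simp only [Matrix.mul_assoc], tr, h3, smul_mul, trace_smul,
        smul_eq_mul, Complex.re_ofReal_mul]
    have e2 : ((E * (P * M))ᴴ * (E * M)).trace = (P * E * ω).trace := by
      rw [← tr, conjTranspose_mul, conjTranspose_mul, h1, hP]
      congr 1
      calc Mᴴ * P * E * (E * M) = Mᴴ * (P * (E * E)) * M := by noncomm_ring
        _ = _ := by rw [h2]
    rw [e1, e2] at h
    rw [← Real.sqrt_mul hf0]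
    refine (Complex.abs_re_le_norm _).trans (Real.le_sqrt_of_sq_le (h.trans_eq (by ring)))
  have c1 := cs Q hQ hQQ c p hPQP rfl
  have c2 := cs (1 - Q) hQ' hQQ' (1 - c) (1 - p) (by
    rw [mul_sub, sub_mul, mul_one, hPP, hPQP, Complex.ofReal_sub, Complex.ofReal_one, sub_smul,
      one_smul]) hp'
  have hsplit : f = (P * Q * ω).trace.re + (P * (1 - Q) * ω).trace.re := by
    rw [← Complex.add_re, ← trace_add, ← add_mul, ← mul_add]; simp [hf]
  have hle : f ≤ √f * (√(c * p) + √((1 - c) * (1 - p))) := by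
    rw [mul_add]
    have := le_abs_self (P * Q * ω).trace.re
    have := le_abs_self (P * (1 - Q) * ω).trace.re
    linarith
  refine le_add_sqrt_one_sub_of_sqrt_le hp0 (sub_nonneg.1 hp1) hc0 hc1 hf0 ?_
  -- `hle` can be divided by `√f` only if `f ≠ 0`.
  rcases hf0.eq_or_lt with h | h
  · rw [← h, Real.sqrt_zero]; positivity
  · refine le_of_mul_le_mul_left ?_ (Real.sqrt_pos.2 h)
    rwa [Real.mul_self_sqrt hf0]

end GentleMeasurement

/-! ### Private states, their tests, and monogamy. -/

section PrivateState

variable {k : ℕ} {S T : Type*} [Fintype S] [DecidableEq S] [Fintype T] [DecidableEq T]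

/-- The isometry `|p⟩ ↦ k^{-1/2} ∑ᵢ |i⟩ ⊗ |i⟩ ⊗ Uⁱ|p⟩` that embeds the shield into key and
shield. -/
noncomputable def shieldIsometry (U : Fin k → Matrix.unitaryGroup (S × T) ℂ) :
    Matrix ((Fin k × S) × (Fin k × T)) (S × T) ℂ :=
  Matrix.of fun x p =>
    if x.1.1 = x.2.1 then ((√(k : ℝ) : ℝ) : ℂ)⁻¹ * (U x.1.1 : Matrix (S × T) (S × T) ℂ)
      (x.1.2, x.2.2) p else 0

theorem inv_sqrt_mul_inv_sqrt (k : ℕ) :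
    ((√(k : ℝ) : ℝ) : ℂ)⁻¹ * ((√(k : ℝ) : ℝ) : ℂ)⁻¹ = (k : ℂ)⁻¹ := by
  rw [← mul_inv, ← Complex.ofReal_mul, Real.mul_self_sqrt (Nat.cast_nonneg k),
    Complex.ofReal_natCast]

theorem sum_star_mul_unitary (U : Matrix.unitaryGroup (S × T) ℂ) (p q : S × T) :
    ∑ x, star ((U : Matrix (S × T) (S × T) ℂ) x p) * (U : Matrix (S × T) (S × T) ℂ) x q =
      (1 : Matrix (S × T) (S × T) ℂ) p q := by
  have h := Matrix.UnitaryGroup.star_mul_self U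
  have := congrFun (congrFun h p) q
  simpa [Matrix.mul_apply, star_eq_conjTranspose] using this

theorem sum_mul_star_unitary (U : Matrix.unitaryGroup (S × T) ℂ) (p q : S × T) :
    ∑ x, (U : Matrix (S × T) (S × T) ℂ) p x * star ((U : Matrix (S × T) (S × T) ℂ) q x) =
      (1 : Matrix (S × T) (S × T) ℂ) p q := by
  have h := (Matrix.mem_unitaryGroup_iff).1 U.2
  have := congrFun (congrFun h p) q
  simpa [Matrix.mul_apply, star_eq_conjTranspose] using this

theorem maxEnt_apply (x y : Fin k × Fin k) :
    maxEnt k x y = if x.1 = x.2 then if y.1 = y.2 then (k : ℂ)⁻¹ else 0 else 0 := by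
  obtain ⟨i, i'⟩ := x
  obtain ⟨j, j'⟩ := y
  simp only [maxEnt, one_div, Matrix.smul_apply, Matrix.sum_apply, kroneckerMap_apply,
    Matrix.single_apply, smul_eq_mul, mul_ite, mul_one, mul_zero, ite_and,
    Finset.sum_ite_irrel, Finset.sum_const_zero, Finset.sum_ite_eq', Finset.mem_univ, if_true]
  split_ifs <;> simp_all

theorem twist_apply (U : Fin k → Matrix.unitaryGroup (S × T) ℂ)
    (x y : (Fin k × Fin k) × (S × T)) :
    twist U x y = if x.1 = y.1 then (U x.1.1 : Matrix (S × T) (S × T) ℂ) x.2 y.2 else 0 := by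
  obtain ⟨⟨i, i'⟩, p⟩ := x
  obtain ⟨⟨j, j'⟩, q⟩ := y
  simp only [twist, Matrix.sum_apply, kroneckerMap_apply, Matrix.single_apply, Matrix.one_apply,
    mul_ite, ite_mul, mul_one, mul_zero, one_mul, zero_mul, ite_and,
    Finset.sum_ite_irrel, Finset.sum_const_zero, Finset.sum_ite_eq', Finset.mem_univ, if_true,
    Prod.mk.injEq]
  split_ifs <;> simp_all

/-- Since `Φ^k` has rank one, `Φ^k ⊗ X` factors as `Z X Zᴴ` with `Z = |Φ^k⟩ ⊗ 1`, and the twist is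
absorbed into `Z`. The cases `X = τ` and `X = 1` give the private state and its test. -/
theorem regroup_twist_maxEnt (U : Fin k → Matrix.unitaryGroup (S × T) ℂ)
    (X : Matrix (S × T) (S × T) ℂ) :
    regroup (twist U * (maxEnt k ⊗ₖ X) * (twist U)ᴴ) =
      shieldIsometry U * X * (shieldIsometry U)ᴴ := by
  have key : (maxEnt k ⊗ₖ X) = (Matrix.of fun (x : (Fin k × Fin k) × (S × T)) (p : S × T) =>
      if x.1.1 = x.1.2 then ((√(k : ℝ) : ℝ) : ℂ)⁻¹ * (1 : Matrix (S × T) (S × T) ℂ) x.2 p else 0) *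
      X * (Matrix.of fun (x : (Fin k × Fin k) × (S × T)) (p : S × T) =>
      if x.1.1 = x.1.2 then ((√(k : ℝ) : ℝ) : ℂ)⁻¹ *
        (1 : Matrix (S × T) (S × T) ℂ) x.2 p else 0)ᴴ := by
    ext ⟨⟨i, i'⟩, p⟩ ⟨⟨j, j'⟩, q⟩
    simp only [kroneckerMap_apply, maxEnt_apply, Matrix.mul_apply, Matrix.of_apply,
      conjTranspose_apply, Matrix.one_apply, mul_ite, mul_one, mul_zero]
    by_cases h : i = i' <;> by_cases h' : j = j'
    · simp only [h, h', if_true, ite_mul, zero_mul, Finset.sum_ite_eq, Finset.mem_univ,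
        apply_ite star, star_zero, mul_ite, mul_zero]
      rw [← inv_sqrt_mul_inv_sqrt]
      simp
      ring
    all_goals simp [h, h']
  set Z : Matrix ((Fin k × Fin k) × (S × T)) (S × T) ℂ := Matrix.of fun x p =>
      if x.1.1 = x.1.2 then ((√(k : ℝ) : ℝ) : ℂ)⁻¹ * (1 : Matrix (S × T) (S × T) ℂ) x.2 p else 0
    with hZ
  have hY : shieldIsometry U = (twist U * Z).submatrix (Equiv.prodProdProdComm _ _ _ _).symm id := by
    ext ⟨⟨i, s⟩, ⟨i', t⟩⟩ p
    rw [Matrix.submatrix_apply, Matrix.mul_apply, Fintype.sum_prod_type,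
      Finset.sum_eq_single (i, i')]
    · by_cases h : i = i' <;>
        simp [shieldIsometry, twist_apply, hZ, Matrix.one_apply, h, mul_comm]
    · intro x _ hx
      simp [twist_apply, hx.symm]
    · simp
  rw [key, hY, regroup, Matrix.reindex_apply]
  have : twist U * (Z * X * Zᴴ) * (twist U)ᴴ = (twist U * Z) * X * (twist U * Z)ᴴ := by
    rw [conjTranspose_mul]; simp only [Matrix.mul_assoc]
  rw [this]
  ext x y
  simp [Matrix.mul_apply]

theorem privateState_eq (U : Fin k → Matrix.unitaryGroup (S × T) ℂ)
    (τ : Matrix (S × T) (S × T) ℂ) :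
    privateState U τ = shieldIsometry U * τ * (shieldIsometry U)ᴴ :=
  regroup_twist_maxEnt U τ

theorem privacyTest_eq (U : Fin k → Matrix.unitaryGroup (S × T) ℂ) :
    privacyTest U = shieldIsometry U * (shieldIsometry U)ᴴ := by
  rw [privacyTest, regroup_twist_maxEnt, Matrix.mul_one]

theorem shieldIsometry_isometry (hk : 1 ≤ k) (U : Fin k → Matrix.unitaryGroup (S × T) ℂ) :
    (shieldIsometry U)ᴴ * shieldIsometry U = 1 := by
  have hk0 : (k : ℂ) ≠ 0 := by exact_mod_cast (by omega : k ≠ 0)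
  ext p q
  have h : ∀ i : Fin k, ∑ s : S, ∑ t : T, (k : ℂ)⁻¹ *
      (star ((U i : Matrix (S × T) (S × T) ℂ) (s, t) p) *
        (U i : Matrix (S × T) (S × T) ℂ) (s, t) q) =
      (k : ℂ)⁻¹ * (1 : Matrix (S × T) (S × T) ℂ) p q := by
    intro i
    rw [← sum_star_mul_unitary (U i), Finset.mul_sum, Fintype.sum_prod_type]
  have h2 : ((shieldIsometry U)ᴴ * shieldIsometry U) p q =
      ∑ i : Fin k, ∑ s : S, ∑ t : T, (k : ℂ)⁻¹ *
      (star ((U i : Matrix (S × T) (S × T) ℂ) (s, t) p) *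
        (U i : Matrix (S × T) (S × T) ℂ) (s, t) q) := by
    simp only [Matrix.mul_apply, Fintype.sum_prod_type, conjTranspose_apply, shieldIsometry,
      Matrix.of_apply]
    refine Finset.sum_congr rfl fun i _ => Finset.sum_congr rfl fun s _ => ?_
    rw [Finset.sum_eq_single i]
    · refine Finset.sum_congr rfl fun t _ => ?_
      rw [← inv_sqrt_mul_inv_sqrt]
      simp
      ring
    · intro j _ hj
      simp [hj.symm]
    · simp
  rw [h2, Finset.sum_congr rfl fun i _ => h i]
  simp [hk0]

theorem privacyTest_conjTranspose (U : Fin k → Matrix.unitaryGroup (S × T) ℂ) :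
    (privacyTest U)ᴴ = privacyTest U := by
  simp [privacyTest_eq]

theorem privacyTest_mul_self (hk : 1 ≤ k) (U : Fin k → Matrix.unitaryGroup (S × T) ℂ) :
    privacyTest U * privacyTest U = privacyTest U := by
  rw [privacyTest_eq, Matrix.mul_assoc, ← Matrix.mul_assoc _ᴴ, shieldIsometry_isometry hk,
    Matrix.one_mul]

theorem privacyTest_mul_privateState (hk : 1 ≤ k) (U : Fin k → Matrix.unitaryGroup (S × T) ℂ)
    (τ : Matrix (S × T) (S × T) ℂ) : privacyTest U * privateState U τ = privateState U τ := by
  rw [privacyTest_eq, privateState_eq]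
  simp only [Matrix.mul_assoc]
  rw [← Matrix.mul_assoc (shieldIsometry U)ᴴ (shieldIsometry U), shieldIsometry_isometry hk,
    Matrix.one_mul]

theorem isState_privateState (hk : 1 ≤ k) (U : Fin k → Matrix.unitaryGroup (S × T) ℂ)
    {τ : Matrix (S × T) (S × T) ℂ} (hτ : IsState τ) : IsState (privateState U τ) := by
  rw [privateState_eq]
  refine ⟨hτ.1.mul_mul_conjTranspose_same _, ?_⟩
  rw [trace_mul_comm, ← Matrix.mul_assoc, shieldIsometry_isometry hk, Matrix.one_mul, hτ.2]

/-- A system and its copy are exchanged. -/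
def swapCopy (A B E : Type*) : (A × B) × E ≃ (A × E) × B where
  toFun x := ((x.1.1, x.2), x.1.2)
  invFun x := ((x.1.1, x.2), x.1.2)
  left_inv _ := rfl
  right_inv _ := rfl

/-- Only blocks diagonal in Alice's key are computed: there both sides carry the same `Uⁱ`, which
cancels, so the block does not depend on the twist. -/
theorem privacyTest_apply_diag (U : Fin k → Matrix.unitaryGroup (S × T) ℂ) (i : Fin k) (s s' : S)
    (x y : Fin k × T) :
    privacyTest U ((i, s), x) ((i, s'), y) = if i = x.1 ∧ x = y ∧ s = s' then (k : ℂ)⁻¹ else 0 := by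
  obtain ⟨e, t⟩ := x
  obtain ⟨f, t'⟩ := y
  simp only [privacyTest_eq, Matrix.mul_apply, conjTranspose_apply, shieldIsometry,
    Matrix.of_apply]
  by_cases h : i = e
  · by_cases h' : i = f
    · subst h h'
      have := sum_mul_star_unitary (U i) (s, t) (s', t')
      simp only [if_true, star_mul']
      calc _ = ∑ p, (k : ℂ)⁻¹ * ((U i : Matrix (S × T) (S × T) ℂ) (s, t) p *
              star ((U i : Matrix (S × T) (S × T) ℂ) (s', t') p)) := by
            refine Finset.sum_congr rfl fun p _ => ?_
            rw [← inv_sqrt_mul_inv_sqrt]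
            simp
            ring
        _ = _ := by
          rw [← Finset.mul_sum, this, Matrix.one_apply]
          simp only [Prod.mk.injEq, mul_ite, mul_one, mul_zero, true_and]
          exact if_congr and_comm rfl rfl
    · have : e ≠ f := h ▸ h'
      simp [h', this]
  · simp [h]

theorem conjTranspose_kronecker_one_mul_mul_apply {m n l : Type*} [Fintype m] [DecidableEq m]
    [Fintype n] [Fintype l] [DecidableEq l] (Y : Matrix m n ℂ) (Q : Matrix (m × l) (m × l) ℂ)
    (p q : n) (e f : l) :
    ((Y ⊗ₖ (1 : Matrix l l ℂ))ᴴ * Q * (Y ⊗ₖ (1 : Matrix l l ℂ))) (p, e) (q, f) =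
      ∑ c, ∑ a, star (Y a p) * Q (a, e) (c, f) * Y c q := by
  simp only [Matrix.mul_apply, conjTranspose_apply, kroneckerMap_apply, Matrix.one_apply,
    Fintype.sum_prod_type, Finset.sum_mul]
  refine Finset.sum_congr rfl fun c _ => ?_
  rw [Finset.sum_eq_single f]
  · refine Finset.sum_congr rfl fun a _ => ?_
    rw [Finset.sum_eq_single e]
    · simp
    · intro b _ hb
      simp [hb]
    · simp
  · intro b _ hb
    simp [hb]
  · simp

/-- Testing the key against Bob before and after testing it against the copy of Bob succeeds with
`1 / k²` of the probability of the first test. -/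
theorem privacyTest_sandwich (U : Fin k → Matrix.unitaryGroup (S × T) ℂ) :
    (privacyTest U ⊗ₖ (1 : Matrix (Fin k × T) (Fin k × T) ℂ)) *
        (privacyTest U ⊗ₖ (1 : Matrix (Fin k × T) (Fin k × T) ℂ)).submatrix
          (swapCopy _ _ _) (swapCopy _ _ _) *
        (privacyTest U ⊗ₖ (1 : Matrix (Fin k × T) (Fin k × T) ℂ)) =
      ((1 / (k : ℝ) ^ 2 : ℝ) : ℂ) • (privacyTest U ⊗ₖ (1 : Matrix (Fin k × T) (Fin k × T) ℂ)) := by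
  set Y := shieldIsometry U with hY
  set I := (1 : Matrix (Fin k × T) (Fin k × T) ℂ) with hI
  set Q := (privacyTest U ⊗ₖ I).submatrix (swapCopy _ _ _) (swapCopy _ _ _) with hQ
  have hP : privacyTest U ⊗ₖ I = (Y ⊗ₖ I) * (Y ⊗ₖ I)ᴴ := by
    rw [conjTranspose_kronecker, ← mul_kronecker_mul, ← privacyTest_eq, hI]; simp
  have key : (Y ⊗ₖ I)ᴴ * Q * (Y ⊗ₖ I) = ((1 / (k : ℝ) ^ 2 : ℝ) : ℂ) • 1 := by
    ext ⟨p, e⟩ ⟨q, f⟩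
    rw [hI, conjTranspose_kronecker_one_mul_mul_apply]
    -- `Y` forces Alice's key to equal Bob's, and `Q` is the identity on Bob. Alice's key is thus
    -- the same on both sides of `Q`, and only the twist-free diagonal blocks of the test enter.
    have term : ∀ c a : (Fin k × S) × (Fin k × T), star (Y a p) * Q (a, e) (c, f) * Y c q =
        if a = c then
          if c.1.1 = e.1 ∧ e = f then (k : ℂ)⁻¹ * (star (Y c p) * Y c q) else 0 else 0 := by
      rintro ⟨⟨j, s'⟩, ⟨j', t'⟩⟩ ⟨⟨i, s⟩, ⟨i', t⟩⟩
      by_cases hi : i = i'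
      · by_cases hj : j = j'
        · subst hi hj
          by_cases h : (i, t) = (j, t')
          · obtain ⟨rfl, rfl⟩ := Prod.mk.inj h
            have : Q (((i, s), (i, t)), e) (((i, s'), (i, t)), f) =
                if i = e.1 ∧ e = f ∧ s = s' then (k : ℂ)⁻¹ else 0 := by
              simp only [hQ, hI, swapCopy, Equiv.coe_fn_mk, Matrix.submatrix_apply,
                kroneckerMap_apply, privacyTest_apply_diag, Matrix.one_apply_eq, mul_one]
            rw [this]
            by_cases hs : s = s'
            · subst hs
              by_cases h1 : i = e.1 ∧ e = f
              · simp [h1.1, h1.2]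
                ring
              · have h1' : ¬ (i = e.1 ∧ e = f ∧ s = s) := fun h => h1 ⟨h.1, h.2.1⟩
                rw [if_neg h1', if_pos rfl, if_neg h1]
                simp
            · simp [hs]
          · have : Q (((i, s), (i, t)), e) (((j, s'), (j, t')), f) = 0 := by
              simp [hQ, hI, swapCopy, Matrix.one_apply_ne h]
            rw [this, if_neg fun h' => h (congrArg Prod.snd h')]
            simp
        · simp [hY, shieldIsometry, hj]
      · have : Y ((i, s), (i', t)) p = 0 := by simp [hY, shieldIsometry, hi]
        rw [this]
        split_ifs with h1
        · rw [← h1, this]; simp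
        · simp
        · simp
    simp only [term, Finset.sum_ite_eq', Finset.mem_univ, if_true]
    by_cases hef : e = f
    · subst hef
      have h := sum_star_mul_unitary (U e.1) p q
      -- One factor `1 / k` comes from the test against `E`; the other is the probability that the
      -- key shared with Bob has the value held by `E`.
      have h2 : ∑ x, (if x.1.1 = e.1 ∧ e = e then (k : ℂ)⁻¹ * (star (Y x p) * Y x q) else 0) =
          ∑ x : S × T, (k : ℂ)⁻¹ * (k : ℂ)⁻¹ * (star ((U e.1 : Matrix (S × T) (S × T) ℂ) x p) *
            (U e.1 : Matrix (S × T) (S × T) ℂ) x q) := by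
        simp only [Fintype.sum_prod_type, and_true]
        rw [Finset.sum_eq_single e.1]
        · refine Finset.sum_congr rfl fun s _ => ?_
          rw [Finset.sum_eq_single e.1]
          · refine Finset.sum_congr rfl fun t _ => ?_
            rw [← inv_sqrt_mul_inv_sqrt]
            simp [hY, shieldIsometry]
            ring
          · intro j _ hj
            simp [hY, shieldIsometry, hj.symm]
          · simp
        · intro j _ hj
          simp [hj]
        · simp
      rw [h2, ← Finset.mul_sum, h]
      simp [Matrix.one_apply, pow_two]
    · simp [hef]
  rw [hP]
  calc _ = (Y ⊗ₖ I) * ((Y ⊗ₖ I)ᴴ * Q * (Y ⊗ₖ I)) * (Y ⊗ₖ I)ᴴ := by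
        simp only [Matrix.mul_assoc]
    _ = _ := by rw [key]; simp

end PrivateState

/-! ### Partial traces and local channels. -/

section PartialTrace

variable {A B E A' B' E' : Type*}

theorem traceE_sum [Fintype E] {κ : Type*} (s : Finset κ)
    (f : κ → Matrix ((A × B) × E) ((A × B) × E) ℂ) :
    traceE (∑ x ∈ s, f x) = ∑ x ∈ s, traceE (f x) := by
  ext p q
  simp only [traceE, Matrix.of_apply, Matrix.sum_apply]
  exact Finset.sum_comm

theorem traceB_eq_traceE [Fintype B] (ω : Matrix ((A × B) × E) ((A × B) × E) ℂ) :
    traceB ω = traceE (ω.submatrix (swapCopy A B E).symm (swapCopy A B E).symm) := rfl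

variable [Fintype A] [Fintype B] [Fintype E]

/-- The adjoint of the partial trace is `Z ↦ Z ⊗ 1`; identities for partial traces are derived from
this duality. -/
theorem trace_mul_traceE [DecidableEq E] (Z : Matrix (A × B) (A × B) ℂ)
    (ω : Matrix ((A × B) × E) ((A × B) × E) ℂ) :
    (Z * traceE ω).trace = ((Z ⊗ₖ (1 : Matrix E E ℂ)) * ω).trace := by
  simp only [Matrix.trace, Matrix.diag_apply, Matrix.mul_apply, traceE, Matrix.of_apply,
    Fintype.sum_prod_type (f := fun x : (A × B) × E => _), kroneckerMap_apply, Matrix.one_apply,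
    mul_ite, mul_one, mul_zero, ite_mul, zero_mul, Finset.sum_ite_eq, Finset.mem_univ, if_true,
    Finset.mul_sum]
  exact Finset.sum_congr rfl fun x _ => Finset.sum_comm

theorem trace_traceE [DecidableEq A] [DecidableEq B] [DecidableEq E]
    (ω : Matrix ((A × B) × E) ((A × B) × E) ℂ) :
    (traceE ω).trace = ω.trace := by
  simpa using trace_mul_traceE 1 ω

theorem trace_mul_traceB [DecidableEq B] (Z : Matrix (A × E) (A × E) ℂ)
    (ω : Matrix ((A × B) × E) ((A × B) × E) ℂ) :
    (Z * traceB ω).trace =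
      ((Z ⊗ₖ (1 : Matrix B B ℂ)).submatrix (swapCopy A B E) (swapCopy A B E) * ω).trace := by
  rw [traceB_eq_traceE, trace_mul_traceE]
  have : (Z ⊗ₖ (1 : Matrix B B ℂ)) *
      ω.submatrix (swapCopy A B E).symm (swapCopy A B E).symm =
      ((Z ⊗ₖ (1 : Matrix B B ℂ)).submatrix (swapCopy A B E) (swapCopy A B E) * ω).submatrix
        (swapCopy A B E).symm (swapCopy A B E).symm := by
    rw [← Matrix.submatrix_mul_equiv _ _ _ (swapCopy A B E).symm]
    congr 1
  rw [this]
  exact Equiv.sum_comp (swapCopy A B E).symm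
    (fun x => ((Z ⊗ₖ (1 : Matrix B B ℂ)).submatrix (swapCopy A B E) (swapCopy A B E) * ω) x x)

/-- A local channel on the system `E`, given by Kraus operators, is invisible after tracing out
`E`. -/
theorem traceE_sum_kronecker {ι : Type*} [Fintype ι] [DecidableEq E] [Fintype A'] [Fintype B']
    [Fintype E'] [DecidableEq E']
    (G : Matrix (A' × B') (A × B) ℂ) (J : ι → Matrix E' E ℂ)
    (hJ : ∑ t, (J t)ᴴ * J t = 1) (ω : Matrix ((A × B) × E) ((A × B) × E) ℂ) :
    traceE (∑ t, (G ⊗ₖ J t) * ω * (G ⊗ₖ J t)ᴴ) = G * traceE ω * Gᴴ := by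
  rw [Matrix.ext_iff_trace_mul_left]
  intro Z
  rw [trace_mul_traceE, Finset.mul_sum, trace_sum]
  have h : ∀ t, ((Z ⊗ₖ (1 : Matrix E' E' ℂ)) * ((G ⊗ₖ J t) * ω * (G ⊗ₖ J t)ᴴ)).trace =
      (((Gᴴ * Z * G) ⊗ₖ ((J t)ᴴ * J t)) * ω).trace := by
    intro t
    rw [← Matrix.mul_assoc, trace_mul_comm, ← Matrix.mul_assoc, ← Matrix.mul_assoc,
      conjTranspose_kronecker, ← mul_kronecker_mul, ← mul_kronecker_mul, Matrix.mul_one]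
  rw [Finset.sum_congr rfl fun t _ => h t, ← trace_sum, ← Finset.sum_mul]
  have h2 : ∑ t, (Gᴴ * Z * G) ⊗ₖ ((J t)ᴴ * J t) = (Gᴴ * Z * G) ⊗ₖ (1 : Matrix E E ℂ) := by
    rw [← hJ]
    ext x y
    simp [Matrix.sum_apply, Finset.mul_sum]
  rw [h2, ← trace_mul_traceE, Matrix.mul_assoc, Matrix.mul_assoc, trace_mul_comm]
  simp only [Matrix.mul_assoc]

end PartialTrace

/-! ### Choi matrices and Kraus operators. -/

section Kraus

theorem sum_conjTranspose_mul_self_eq_one {A A' ι : Type*} [Fintype A] [DecidableEq A]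
    [Fintype A'] [Fintype ι] {K : ι → Matrix A' A ℂ}
    (h : ∀ X : Matrix A A ℂ, (∑ r, K r * X * (K r)ᴴ).trace = X.trace) :
    ∑ r, (K r)ᴴ * K r = 1 := by
  rw [Matrix.ext_iff_trace_mul_right]
  intro X
  rw [Matrix.one_mul, ← h X, Finset.sum_mul, trace_sum, trace_sum]
  refine Finset.sum_congr rfl fun r _ => ?_
  rw [trace_mul_comm (K r * X), Matrix.mul_assoc]

theorem sum_kraus_kronecker_eq_one {A A' B B' ι κ : Type*} [DecidableEq A] [Fintype A']
    [DecidableEq B] [Fintype B'] [Fintype ι] [Fintype κ] {r : ℕ}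
    {K : Fin r → ι → Matrix A' A ℂ} {J : Fin r → κ → Matrix B' B ℂ}
    (hK : ∑ x, ∑ i, (K x i)ᴴ * K x i = 1) (hJ : ∀ x, ∑ j, (J x j)ᴴ * J x j = 1) :
    ∑ x, ∑ i, ∑ j, (K x i ⊗ₖ J x j)ᴴ * (K x i ⊗ₖ J x j) = 1 := by
  have h : ∀ x i, ∑ j, (K x i ⊗ₖ J x j)ᴴ * (K x i ⊗ₖ J x j) =
      ((K x i)ᴴ * K x i) ⊗ₖ (1 : Matrix B B ℂ) := by
    intro x i
    rw [← hJ x]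
    ext p q
    simp only [conjTranspose_kronecker, ← mul_kronecker_mul, Matrix.sum_apply, kroneckerMap_apply,
      Finset.mul_sum]
  simp only [h]
  rw [← one_kronecker_one, ← hK]
  ext p q
  simp only [Matrix.sum_apply, kroneckerMap_apply, Finset.sum_mul]

variable {A A' B B' : Type*} [Fintype A] [DecidableEq A] [Fintype A'] [DecidableEq A']
  [Fintype B] [DecidableEq B] [Fintype B'] [DecidableEq B']

theorem tensorMap_kronecker (𝓔 : Matrix A A ℂ →ₗ[ℂ] Matrix A' A' ℂ)
    (𝓓 : Matrix B B ℂ →ₗ[ℂ] Matrix B' B' ℂ) (X : Matrix A A ℂ) (Y : Matrix B B ℂ) :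
    tensorMap 𝓔 𝓓 (X ⊗ₖ Y) = 𝓔 X ⊗ₖ 𝓓 Y := by
  simp [tensorMap]

/-- The matrix of a completely positive map under the Choi isomorphism is positive. -/
theorem posSemidef_choi {𝓔 : Matrix A A ℂ →ₗ[ℂ] Matrix A' A' ℂ} (h : IsCP 𝓔) :
    (Matrix.of fun x y : A × A' => 𝓔 (Matrix.single x.1 y.1 1) x.2 y.2).PosSemidef := by
  let e := Fintype.equivFin A
  -- The unnormalised maximally entangled vector, with the reference copy of `A` indexed by `Fin` as
  -- in `IsCP`.
  let v : Fin (Fintype.card A) × A → ℂ := fun x => if x.1 = e x.2 then 1 else 0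
  have hv := h _ _ (posSemidef_vecMulVec_self_star v)
  have hM : vecMulVec v (star v) =
      ∑ i, ∑ j, Matrix.single (e i) (e j) 1 ⊗ₖ Matrix.single i j 1 := by
    ext ⟨x, i⟩ ⟨y, j⟩
    simp only [Matrix.sum_apply, kroneckerMap_apply, vecMulVec_apply]
    rw [Finset.sum_eq_single i, Finset.sum_eq_single j]
    · by_cases h1 : x = e i <;> by_cases h2 : y = e j <;>
        simp [v, h1, h2, eq_comm]
    · intro b _ hb
      simp [Matrix.single_apply, hb]
    · simp
    · intro b _ hb
      simp [Matrix.single_apply, hb]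
    · simp
  rw [hM] at hv
  simp only [map_sum, tensorMap_kronecker, LinearMap.id_coe, id] at hv
  have := hv.submatrix (fun x : A × A' => (e x.1, x.2))
  convert this using 1
  ext ⟨i, a⟩ ⟨j, b⟩
  simp only [Matrix.of_apply, Matrix.submatrix_apply, Matrix.sum_apply, kroneckerMap_apply]
  rw [Finset.sum_eq_single i, Finset.sum_eq_single j]
  · simp
  · intro c _ hc
    simp [hc]
  · simp
  · intro c _ hc
    simp [hc]
  · simp

theorem exists_kraus {𝓔 : Matrix A A ℂ →ₗ[ℂ] Matrix A' A' ℂ} (h : IsCP 𝓔) :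
    ∃ K : A × A' → Matrix A' A ℂ, ∀ X, 𝓔 X = ∑ r, K r * X * (K r)ᴴ := by
  obtain ⟨C, hC⟩ := CStarAlgebra.nonneg_iff_eq_star_mul_self.1 (posSemidef_choi h).nonneg
  -- Each Kraus operator is the conjugate of a row of a factor `C` of the Choi matrix `CᴴC`,
  -- reshaped to a matrix.
  let K : A × A' → Matrix A' A ℂ := fun r => Matrix.of fun a i => star (C r (i, a))
  refine ⟨K, fun X => ?_⟩
  let 𝓚 : Matrix A A ℂ →ₗ[ℂ] Matrix A' A' ℂ :=
    { toFun := fun X => ∑ r, K r * X * (K r)ᴴ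
      map_add' := fun X Y => by
        simp [Matrix.mul_add, Matrix.add_mul, Finset.sum_add_distrib]
      map_smul' := fun c X => by simp [Finset.smul_sum] }
  suffices 𝓔 = 𝓚 from congrArg (fun f => f X) this
  refine Matrix.ext_linearMap _ fun i j => LinearMap.ext_ring ?_
  ext a b
  have := congrFun (congrFun hC (i, a)) (j, b)
  simp only [Matrix.of_apply, star_eq_conjTranspose, Matrix.mul_apply, conjTranspose_apply] at this
  change 𝓔 (Matrix.single i j 1) a b = (∑ r, K r * Matrix.single i j 1 * (K r)ᴴ : Matrix A' A' ℂ) a b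
  rw [this, Matrix.sum_apply]
  refine Finset.sum_congr rfl fun r _ => ?_
  rw [Matrix.mul_apply, Finset.sum_eq_single j]
  · simp [K]
  · intro c _ hc
    rw [Matrix.mul_single_apply_of_ne _ _ _ _ _ hc, zero_mul]
  · simp

theorem tensorMap_kraus {ι κ : Type*} [Fintype ι] [Fintype κ]
    {𝓔 : Matrix A A ℂ →ₗ[ℂ] Matrix A' A' ℂ} {𝓓 : Matrix B B ℂ →ₗ[ℂ] Matrix B' B' ℂ}
    {K : ι → Matrix A' A ℂ} {J : κ → Matrix B' B ℂ}
    (hK : ∀ X, 𝓔 X = ∑ r, K r * X * (K r)ᴴ) (hJ : ∀ X, 𝓓 X = ∑ s, J s * X * (J s)ᴴ)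
    (X : Matrix (A × B) (A × B) ℂ) :
    tensorMap 𝓔 𝓓 X = ∑ r, ∑ s, (K r ⊗ₖ J s) * X * (K r ⊗ₖ J s)ᴴ := by
  let 𝓚 : Matrix (A × B) (A × B) ℂ →ₗ[ℂ] Matrix (A' × B') (A' × B') ℂ :=
    { toFun := fun X => ∑ r, ∑ s, (K r ⊗ₖ J s) * X * (K r ⊗ₖ J s)ᴴ
      map_add' := fun X Y => by
        simp [Matrix.mul_add, Matrix.add_mul, Finset.sum_add_distrib]
      map_smul' := fun c X => by simp [Finset.smul_sum] }
  suffices tensorMap 𝓔 𝓓 = 𝓚 from congrArg (fun f => f X) this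
  refine Matrix.ext_linearMap _ fun ⟨i, i'⟩ ⟨j, j'⟩ => LinearMap.ext_ring ?_
  have hs : Matrix.single (i, i') (j, j') (1 : ℂ) = Matrix.single i j 1 ⊗ₖ Matrix.single i' j' 1 := by
    rw [Matrix.single_kronecker_single, one_mul]
  change tensorMap 𝓔 𝓓 (Matrix.single (i, i') (j, j') 1) =
    ∑ r, ∑ s, (K r ⊗ₖ J s) * (Matrix.single (i, i') (j, j') 1) * (K r ⊗ₖ J s)ᴴ
  rw [hs, tensorMap_kronecker, hK, hJ]
  ext x y
  simp only [conjTranspose_kronecker, ← mul_kronecker_mul, Matrix.sum_apply, kroneckerMap_apply,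
    Finset.sum_mul_sum]

end Kraus

/-! ### One-way LOCC acting on effects and on extensions. -/

section OneWayLOCC

variable {A A' B B' : Type*} [Fintype A] [DecidableEq A] [Fintype A'] [DecidableEq A']
  [Fintype B] [DecidableEq B] [Fintype B'] [DecidableEq B']

/-- Kraus operators of a one-way LOCC channel. -/
theorem IsOneWayLOCC.exists_kraus
    {𝓛 : Matrix (A × B) (A × B) ℂ →ₗ[ℂ] Matrix (A' × B') (A' × B') ℂ} (h : IsOneWayLOCC 𝓛) :
    ∃ (r : ℕ) (K : Fin r → A × A' → Matrix A' A ℂ) (J : Fin r → B × B' → Matrix B' B ℂ),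
      ∑ x, ∑ i, (K x i)ᴴ * K x i = 1 ∧ (∀ x, ∑ j, (J x j)ᴴ * J x j = 1) ∧
      ∀ X, 𝓛 X = ∑ x, ∑ i, ∑ j, (K x i ⊗ₖ J x j) * X * (K x i ⊗ₖ J x j)ᴴ := by
  obtain ⟨r, 𝓔, 𝓓, ⟨hE, hET⟩, hD, rfl⟩ := h
  choose K hK using fun x => OneWayKey.exists_kraus (hE x)
  choose J hJ using fun x => OneWayKey.exists_kraus (hD x).1
  refine ⟨r, K, J, ?_, fun x => ?_, fun X => ?_⟩
  · rw [← Fintype.sum_prod_type' (f := fun x i => (K x i)ᴴ * K x i)]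
    refine sum_conjTranspose_mul_self_eq_one fun X => ?_
    rw [← hET X, Fintype.sum_prod_type]
    simp only [LinearMap.sum_apply, hK]
  · refine sum_conjTranspose_mul_self_eq_one fun X => ?_
    rw [← hJ, (hD x).2]
  · simp only [LinearMap.sum_apply]
    exact Finset.sum_congr rfl fun x _ => tensorMap_kraus (hK x) (hJ x) X

/-- The image of an effect under the adjoint of a one-way LOCC channel is an effect. -/
theorem IsOneWayLOCC.exists_adjoint_effect
    {𝓛 : Matrix (A × B) (A × B) ℂ →ₗ[ℂ] Matrix (A' × B') (A' × B') ℂ} (h : IsOneWayLOCC 𝓛)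
    {P : Matrix (A' × B') (A' × B') ℂ} (hP0 : 0 ≤ P) (hP1 : P ≤ 1) :
    ∃ Λ : Matrix (A × B) (A × B) ℂ, 0 ≤ Λ ∧ Λ ≤ 1 ∧
      ∀ X, (Λ * X).trace = (P * 𝓛 X).trace := by
  obtain ⟨r, K, J, hK, hJ, h𝓛⟩ := h.exists_kraus
  have pos : ∀ R : Matrix (A' × B') (A' × B') ℂ, R.PosSemidef →
      (∑ x, ∑ i, ∑ j, (K x i ⊗ₖ J x j)ᴴ * R * (K x i ⊗ₖ J x j)).PosSemidef := fun R hR =>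
    posSemidef_sum _ fun x _ => posSemidef_sum _ fun i _ => posSemidef_sum _ fun j _ =>
      hR.conjTranspose_mul_mul_same _
  refine ⟨∑ x, ∑ i, ∑ j, (K x i ⊗ₖ J x j)ᴴ * P * (K x i ⊗ₖ J x j),
    (pos P (nonneg_iff_posSemidef.1 hP0)).nonneg, ?_, fun X => ?_⟩
  · rw [Matrix.le_iff, ← sum_kraus_kronecker_eq_one hK hJ]
    have := pos (1 - P) (Matrix.le_iff.1 hP1)
    simpa only [Matrix.mul_sub, Matrix.sub_mul, Matrix.mul_one, Finset.sum_sub_distrib] using this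
  · simp only [h𝓛, Finset.sum_mul, Finset.mul_sum, trace_sum]
    refine Finset.sum_congr rfl fun x _ => Finset.sum_congr rfl fun i _ =>
      Finset.sum_congr rfl fun j _ => ?_
    rw [← Matrix.mul_assoc P, trace_mul_comm (P * _)]
    simp only [Matrix.mul_assoc]

theorem IsOneWayLOCC.isState
    {𝓛 : Matrix (A × B) (A × B) ℂ →ₗ[ℂ] Matrix (A' × B') (A' × B') ℂ} (h : IsOneWayLOCC 𝓛)
    {ρ : Matrix (A × B) (A × B) ℂ} (hρ : IsState ρ) : IsState (𝓛 ρ) := by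
  obtain ⟨r, K, J, hK, hJ, h𝓛⟩ := h.exists_kraus
  rw [h𝓛]
  refine ⟨posSemidef_sum _ fun x _ => posSemidef_sum _ fun i _ => posSemidef_sum _ fun j _ =>
      hρ.1.mul_mul_conjTranspose_same _, ?_⟩
  have := congrArg (fun Z => (Z * ρ).trace) (sum_kraus_kronecker_eq_one hK hJ)
  simp only [Matrix.one_mul, hρ.2, Finset.sum_mul, trace_sum] at this
  simp only [trace_sum]
  rw [← this]
  refine Finset.sum_congr rfl fun x _ => Finset.sum_congr rfl fun i _ =>
      Finset.sum_congr rfl fun j _ => ?_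
  rw [trace_mul_comm, Matrix.mul_assoc]

/-- One-way LOCC channels map free states to free states. -/
theorem IsOneWayLOCC.map_mem_freeStates
    {𝓛 : Matrix (A × B) (A × B) ℂ →ₗ[ℂ] Matrix (A' × B') (A' × B') ℂ} (h : IsOneWayLOCC 𝓛)
    {ρ σ : Matrix (A × B) (A × B) ℂ} (hρ : IsState ρ) (hσ : σ ∈ freeStates ρ) :
    𝓛 σ ∈ freeStates (𝓛 ρ) := by
  have hst := h.isState hρ
  obtain ⟨r, K, J, hK, hJ, h𝓛⟩ := h.exists_kraus
  obtain ⟨ω, ⟨hω, rfl⟩, rfl⟩ := hσ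
  -- Alice's outcome `x` goes to both Bob and `E`, who each apply the channel with Kraus operators
  -- `J x`. Tracing out either of them leaves `𝓛` on the other two systems.
  set ω' := ∑ x, ∑ i, ∑ j, ∑ l, ((K x i ⊗ₖ J x j) ⊗ₖ J x l) * ω *
    ((K x i ⊗ₖ J x j) ⊗ₖ J x l)ᴴ with hω'
  have hE : traceE ω' = 𝓛 (traceE ω) := by
    rw [hω', h𝓛]
    rw [traceE_sum]
    refine Finset.sum_congr rfl fun x _ => ?_
    rw [traceE_sum]
    refine Finset.sum_congr rfl fun i _ => ?_
    rw [traceE_sum]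
    exact Finset.sum_congr rfl fun j _ => traceE_sum_kronecker _ (J x) (hJ x) _
  have hB : traceB ω' = 𝓛 (traceB ω) := by
    have hsub : ω'.submatrix (swapCopy A' B' B').symm (swapCopy A' B' B').symm =
        ∑ x, ∑ i, ∑ l, ∑ j, ((K x i ⊗ₖ J x l) ⊗ₖ J x j) *
          ω.submatrix (swapCopy A B B).symm (swapCopy A B B).symm *
          ((K x i ⊗ₖ J x l) ⊗ₖ J x j)ᴴ := by
      have hG : ∀ x i j l, ((K x i ⊗ₖ J x l) ⊗ₖ J x j) =
          ((K x i ⊗ₖ J x j) ⊗ₖ J x l).submatrix (swapCopy A' B' B').symm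
            (swapCopy A B B).symm := by
        intro x i j l
        ext p q
        simp [swapCopy, mul_right_comm]
      have hterm : ∀ x i j l, ((K x i ⊗ₖ J x l) ⊗ₖ J x j) *
          ω.submatrix (swapCopy A B B).symm (swapCopy A B B).symm *
          ((K x i ⊗ₖ J x l) ⊗ₖ J x j)ᴴ = (((K x i ⊗ₖ J x j) ⊗ₖ J x l) * ω *
          ((K x i ⊗ₖ J x j) ⊗ₖ J x l)ᴴ).submatrix (swapCopy A' B' B').symm
            (swapCopy A' B' B').symm := by
        intro x i j l
        rw [hG x i j l, conjTranspose_submatrix, Matrix.submatrix_mul_equiv,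
          Matrix.submatrix_mul_equiv]
      simp only [hterm]
      rw [hω']
      ext p q
      simp only [Matrix.submatrix_apply, Matrix.sum_apply]
      exact Finset.sum_congr rfl fun x _ => Finset.sum_congr rfl fun i _ => Finset.sum_comm
    rw [traceB_eq_traceE, traceB_eq_traceE, hsub, h𝓛]
    rw [traceE_sum]
    refine Finset.sum_congr rfl fun x _ => ?_
    rw [traceE_sum]
    refine Finset.sum_congr rfl fun i _ => ?_
    rw [traceE_sum]
    exact Finset.sum_congr rfl fun j _ => traceE_sum_kronecker _ (J x) (hJ x) _
  refine ⟨ω', ⟨⟨?_, ?_⟩, hE⟩, hB⟩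
  · exact posSemidef_sum _ fun x _ => posSemidef_sum _ fun i _ => posSemidef_sum _ fun j _ =>
      posSemidef_sum _ fun l _ => hω.1.mul_mul_conjTranspose_same _
  · rw [← trace_traceE, hE, hst.2]

end OneWayLOCC

/-! ### The privacy test on free states. -/

section PrivacyTestBound

variable {k : ℕ} {S T : Type*} [Fintype S] [DecidableEq S] [Fintype T] [DecidableEq T]

/-- The free states of a state close to a private state rarely pass the privacy test. -/
theorem privacyTest_trace_le {ε : ℝ} (hk : 1 ≤ k) (U : Fin k → Matrix.unitaryGroup (S × T) ℂ)
    {τ : Matrix (S × T) (S × T) ℂ} (hτ : IsState τ)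
    {σ : Matrix ((Fin k × S) × (Fin k × T)) ((Fin k × S) × (Fin k × T)) ℂ} (hσ : IsState σ)
    (hF : 1 - ε ≤ fidelity σ (privateState U τ)) :
    1 - ε ≤ (privacyTest U * σ).trace.re ∧
      ∀ ω ∈ freeStates σ, (privacyTest U * ω).trace.re ≤ 1 / (k : ℝ) ^ 2 + √ε := by
  have hpass : 1 - ε ≤ (privacyTest U * σ).trace.re :=
    hF.trans (fidelity_le_trace hσ.1 (isState_privateState hk U hτ) (privacyTest_conjTranspose U)
      (privacyTest_mul_self hk U) (privacyTest_mul_privateState hk U τ))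
  refine ⟨hpass, ?_⟩
  rintro _ ⟨ω, ⟨hω, rfl⟩, rfl⟩
  have hP : (privacyTest U ⊗ₖ (1 : Matrix (Fin k × T) (Fin k × T) ℂ))ᴴ =
      privacyTest U ⊗ₖ (1 : Matrix (Fin k × T) (Fin k × T) ℂ) := by
    rw [conjTranspose_kronecker, privacyTest_conjTranspose, conjTranspose_one]
  have hPP : (privacyTest U ⊗ₖ (1 : Matrix (Fin k × T) (Fin k × T) ℂ)) *
      (privacyTest U ⊗ₖ (1 : Matrix (Fin k × T) (Fin k × T) ℂ)) =
      privacyTest U ⊗ₖ (1 : Matrix (Fin k × T) (Fin k × T) ℂ) := by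
    rw [← mul_kronecker_mul, privacyTest_mul_self hk, Matrix.one_mul]
  have hk1 : (1 : ℝ) ≤ (k : ℝ) ^ 2 := one_le_pow₀ (by exact_mod_cast hk)
  have := trace_re_le_add_sqrt hω hP hPP
    (Q := (privacyTest U ⊗ₖ (1 : Matrix (Fin k × T) (Fin k × T) ℂ)).submatrix
      (swapCopy _ _ _) (swapCopy _ _ _))
    (by rw [conjTranspose_submatrix, hP]) (by rw [Matrix.submatrix_mul_equiv, hPP])
    (by positivity) (by rw [div_le_one (by positivity)]; exact hk1) (privacyTest_sandwich U)
  rw [trace_mul_traceB]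
  rw [trace_mul_traceE] at hpass
  exact this.trans (by gcongr; linarith)

theorem privacyTest_nonneg (U : Fin k → Matrix.unitaryGroup (S × T) ℂ) : 0 ≤ privacyTest U := by
  rw [privacyTest_eq]
  exact (posSemidef_self_mul_conjTranspose _).nonneg

theorem privacyTest_le_one (hk : 1 ≤ k) (U : Fin k → Matrix.unitaryGroup (S × T) ℂ) :
    privacyTest U ≤ 1 := by
  have h : 1 - privacyTest U = (1 - privacyTest U)ᴴ * (1 - privacyTest U) := by
    rw [conjTranspose_sub, conjTranspose_one, privacyTest_conjTranspose, sub_mul, mul_sub, mul_sub,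
      privacyTest_mul_self hk]
    simp
  rw [Matrix.le_iff, h]
  exact posSemidef_conjTranspose_mul_self _

end PrivacyTestBound

/-! ### From effects to bounds on `Jmin`. -/

section UnextendibleEntanglement

variable {A B : Type*} [Fintype A] [DecidableEq A] [Fintype B] [DecidableEq B]

theorem elog2_ofReal {c : ℝ} (hc : 0 < c) :
    elog2 (ENNReal.ofReal c) = ((Real.logb 2 c : ℝ) : EReal) := by
  rw [elog2, ENNReal.log_ofReal_of_pos hc, Real.logb, EReal.coe_div]

theorem elog2_mono {x y : ℝ≥0∞} (h : x ≤ y) : elog2 x ≤ elog2 y :=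
  EReal.div_le_div_right_of_nonneg
    (EReal.coe_nonneg.2 (Real.log_nonneg one_le_two)) (ENNReal.log_le_log h)

theorem epow2_mono {x y : EReal} (h : x ≤ y) : epow2 x ≤ epow2 y :=
  EReal.exp_monotone
    (mul_le_mul_of_nonneg_right h (EReal.coe_nonneg.2 (Real.log_nonneg one_le_two)))

theorem epow2_logb {c : ℝ} (hc : 0 < c) :
    epow2 ((Real.logb 2 c : ℝ) : EReal) = ENNReal.ofReal c := by
  rw [epow2, ← EReal.coe_mul, Real.logb, div_mul_cancel₀ _ (Real.log_pos one_lt_two).ne',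
    EReal.exp_coe, Real.exp_log hc]

/-- If for every free state some effect accepts `ρ` and has probability at most `c` on the free
state, then `J_min^ε(ρ) ≤ c`. -/
theorem Jmin_le {ε c : ℝ} {ρ : Matrix (A × B) (A × B) ℂ} (hc : 0 < c)
    (h : ∀ σ ∈ freeStates ρ, ∃ Λ : Matrix (A × B) (A × B) ℂ,
      (0 ≤ Λ ∧ Λ ≤ 1 ∧ 1 - ε ≤ (Λ * ρ).trace.re) ∧ (Λ * σ).trace.re ≤ c) :
    Jmin ε ρ ≤ c := by
  have hD : ∀ σ ∈ freeStates ρ,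
      ((-Real.logb 2 c : ℝ) : EReal) ≤ smoothMinRelEntropy ε ρ σ := by
    intro σ hσ
    obtain ⟨Λ, hΛ, hle⟩ := h σ hσ
    rw [smoothMinRelEntropy, EReal.coe_neg, EReal.neg_le_neg_iff, ← elog2_ofReal hc]
    exact elog2_mono (iInf₂_le_of_le Λ hΛ (ENNReal.ofReal_le_ofReal hle))
  have hE : ((1 / 2 * -Real.logb 2 c : ℝ) : EReal) ≤ smoothMinUnextEnt ε ρ := by
    refine le_iInf₂ fun σ hσ => ?_
    rw [EReal.coe_mul]
    exact mul_le_mul_of_nonneg_left (hD σ hσ) (EReal.coe_nonneg.2 (by norm_num))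
  have hE2 : -(2 * smoothMinUnextEnt ε ρ) ≤ ((Real.logb 2 c : ℝ) : EReal) := by
    rw [EReal.neg_le, ← EReal.coe_neg]
    have := mul_le_mul_of_nonneg_left hE (zero_le_two (α := EReal))
    refine le_trans (le_of_eq ?_) this
    rw [show (2 : EReal) = ((2 : ℝ) : EReal) from rfl, ← EReal.coe_mul]
    congr 1
    ring
  have := epow2_mono hE2
  rw [epow2_logb hc] at this
  exact ENNReal.toReal_le_of_le_ofReal hc.le this

/-- The pulled-back privacy test is a feasible `Λ` for `ρ`, and one and the same `Λ` serves for
every free state. -/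
theorem Jmin_le_of_keyAchievable {ε : ℝ} {ρ : Matrix (A × B) (A × B) ℂ} (hρ : IsState ρ) {k : ℕ}
    (hk : 1 ≤ k) (h : KeyAchievable ε ρ k) : Jmin ε ρ ≤ 1 / (k : ℝ) ^ 2 + √ε := by
  obtain ⟨s, t, U, τ, 𝓛, hτ, h𝓛, hF⟩ := h
  obtain ⟨hpass, hfree⟩ := privacyTest_trace_le hk U hτ (h𝓛.isState hρ) hF
  obtain ⟨Λ, h0, h1, hΛ⟩ :=
    h𝓛.exists_adjoint_effect (privacyTest_nonneg U) (privacyTest_le_one hk U)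
  have hk0 : (0 : ℝ) < k := by exact_mod_cast hk
  refine Jmin_le (by positivity) fun σ hσ => ⟨Λ, ⟨h0, h1, ?_⟩, ?_⟩
  · rwa [hΛ]
  · rw [hΛ]
    exact hfree _ (h𝓛.map_mem_freeStates hρ hσ)

end UnextendibleEntanglement

end OneWayKey

theorem corollary2 {A B : Type*} [Fintype A] [DecidableEq A] [Fintype B] [DecidableEq B]
    (ε : ℝ) (hε0 : 0 < ε) (hε1 : ε < 1) :
    (∀ ρ : Matrix (A × B) (A × B) ℂ, OneWayKey.IsState ρ →
      √ε < OneWayKey.Jmin ε ρ →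
      OneWayKey.Jmin ε ρ ≤ 1 / 4 + ε / 2 + √(3 * ε * (1 - ε)) / 2 →
      OneWayKey.distillableKey ε ρ ≤
        ((-(1 / 2) * Real.logb 2 (OneWayKey.Jmin ε ρ - √ε) : ℝ) : EReal)) ∧
    (∀ (k s t : ℕ), 1 ≤ k →
      ∀ (U : Fin k → Matrix.unitaryGroup (Fin s × Fin t) ℂ)
        (τ : Matrix (Fin s × Fin t) (Fin s × Fin t) ℂ), OneWayKey.IsState τ →
      ∀ σ : Matrix ((Fin k × Fin s) × (Fin k × Fin t)) ((Fin k × Fin s) × (Fin k × Fin t)) ℂ,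
        OneWayKey.IsState σ →
        1 - ε ≤ OneWayKey.fidelity σ (OneWayKey.privateState U τ) →
      ∀ ω ∈ OneWayKey.freeStates σ,
        (OneWayKey.privacyTest U * ω).trace.re ≤ 1 / (k : ℝ) ^ 2 + √ε) := by
  refine ⟨fun ρ hρ hJ _ => ?_, fun k s t hk U τ hτ σ hσ hF =>
    (OneWayKey.privacyTest_trace_le hk U hτ hσ hF).2⟩
  refine iSup_le fun k => iSup_le fun hk => iSup_le fun h => EReal.coe_le_coe_iff.2 ?_
  have hle := OneWayKey.Jmin_le_of_keyAchievable hρ hk h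
  have hk0 : (0 : ℝ) < k := by exact_mod_cast hk
  -- `√ε < J` makes the argument of the left logarithm positive, as monotonicity requires; the right
  -- side equals `-2 log₂ k`.
  have hlog : Real.logb 2 (OneWayKey.Jmin ε ρ - √ε) ≤ Real.logb 2 (1 / (k : ℝ) ^ 2) :=
    Real.logb_le_logb_of_le one_lt_two (sub_pos.2 hJ) (by linarith)
  rw [one_div, Real.logb_inv, Real.logb_pow] at hlog
  push_cast at hlog
  linarith
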